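/- \textbf{Setting.} Let $Q$ be a $\mathbb Z^2$-quiver: a nonempty quiver whose arrows are partitioned into three types $0,1,2$ such that (i) exactly one arrow of each type leaves each vertex; (ii) each vertex is connected to each other by an \emph{admissible} path, i.e.\ a path missing some arrow type; (iii) two paths leaving the same vertex arrive at the same vertex if and only if the difference of their numbers of arrows of type $a$ does not depend on $a$. A path is \emph{simple} if it contains at most one arrow of each type, and a \emph{minimal circuit} is a simple non-admissible path. Two distinct vertices are \emph{neighbors} if a simple path connects the first to the second. Let $k$ be a field and $\mathfrak V$ a representation of $Q$ in a $k$-linear Abelian category, with objects $V_v$ and maps $\varphi_\gamma$ along paths $\gamma$. It is \emph{simple} if all $V_v$ are simple objects. It is a \emph{linked net} if: (1) $\varphi_{\gamma_1}$ is a scalar multiple of $\varphi_{\gamma_2}$ whenever $\gamma_1,\gamma_2$ connect the same two vertices and $\gamma_2$ is admissible; (2) $\varphi_\gamma=0$ for each minimal circuit $\gamma$; (3) $\operatorname{Ker}\varphi_{\gamma_1}\cap\operatorname{Ker}\varphi_{\gamma_2}=0$ for all admissible paths $\gamma_1,\gamma_2$ leaving the same vertex with no arrow type in common. It is \emph{exact}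 if $\operatorname{Im}\varphi_\gamma=\operatorname{Ker}\varphi_{\delta}$ for all neighbors $v_1,v_2$ and all admissible paths $\gamma$ from $v_1$ to $v_2$ and $\delta$ from $v_2$ to $v_1$. It is \emph{locally finite} if for each vertex $v$ there is $\ell$ with $\varphi_\mu=0$ for all paths $\mu$ arriving at $v$ of length greater than $\ell$. A set $H$ of vertices \emph{$1$-generates} $\mathfrak V$ if for each vertex $v$ some $\varphi_\gamma$ with $\gamma$ a path from a vertex of $H$ to $v$ is an epimorphism; it \emph{generates} $\mathfrak V$ if each $V_v$ is the sum of the images of finitely many $\varphi_\gamma$ with $\gamma$ paths from vertices of $H$ to $v$. In either case it does so \emph{minimally} if no proper subset of $H$ does. \textbf{Configurations.} Draw $Q$ in the plane: identify its vertices with the pairs $(X,Y)\in\mathbb Z^2$ with $X+Y$ odd, placed at $(\tfrac{\sqrt3}{2}X,\tfrac12Y)$, such that arrows of types $0,1,2$ have displacement $(1,1)$, $(-1,1)$, $(0,-2)$ in the coordinates $(X,Y)$, respectively. Such a drawing is unique up to translation. We say that $\mathfrak V$ \emph{admits a configuration} of one of the types I--V below if, for some such drawing, the listed red arrows (given by type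 and initial vertex) correspond to zero maps and the listed blue arrows correspond to nonzero maps. \begin{itemize} \item[I:] orange $(1,2), (0,1)$. Red: type $0$ from $(-2,3), (-1,2), (0,-3), (0,-1), (0,1)$; type $1$ from $(1,-2), (1,0)$; type $2$ from $(-1,4), (0,3)$. Blue: type $0$ from $(1,2)$; type $1$ from $(-1,2), (0,1), (0,3), (1,2)$; type $2$ from $(0,-1), (0,1), (1,0), (1,2)$. \item[II:] orange $(1,0), (0,1)$. Red: type $0$ from $(0,-3), (0,-1)$; type $1$ from $(1,-4), (1,-2), (1,0), (2,1), (3,2)$; type $2$ from $(1,2), (2,3)$. Blue: type $0$ from $(0,1), (1,0), (1,2), (2,1)$; type $1$ from $(0,1)$; type $2$ from $(0,-1), (0,1), (1,-2), (1,0)$. \item[III:] orange $(0,-1), (0,1)$. Red: type $0$ from $(-2,1), (-1,0)$; type $1$ from $(1,0), (2,1)$; type $2$ from $(-2,3), (-1,2), (0,1), (1,2), (2,3)$. Blue: type $0$ from $(0,-1), (0,1), (1,0), (1,2)$; type $1$ from $(-1,0), (-1,2), (0,-1), (0,1)$; type $2$ from $(0,-1)$. \item[IV:] orange $(1,2), (0,1),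 (0,3)$. Red: type $0$ from $(-2,3), (-1,2), (0,-3), (0,-1), (0,1)$; type $1$ from $(1,-2), (1,0), (1,2), (2,3), (3,4)$; type $2$ from $(-2,5), (-1,4), (0,3), (1,4), (2,5)$. Blue: type $0$ from $(0,3), (1,2), (1,4), (2,3)$; type $1$ from $(-1,2), (-1,4), (0,1), (0,3)$; type $2$ from $(0,-1), (0,1), (1,0), (1,2)$. \item[V:] orange $(1,2), (1,4), (0,3)$. Red: type $0$ from $(-2,5), (-1,4), (0,-1), (0,1), (0,3)$; type $1$ from $(1,-2), (1,0), (1,2), (2,3), (3,4)$; type $2$ from $(-1,6), (0,5), (1,4), (2,5), (3,6)$. Blue: type $0$ from $(1,2), (1,4), (2,3), (2,5)$; type $1$ from $(-1,4), (0,3), (0,5), (1,4)$; type $2$ from $(0,1), (0,3), (1,0), (1,2)$. \end{itemize} \textbf{Theorem.} Every non-exact locally finite simple linked net over $Q$ admits a configuration of type I, II, III, IV or V. Whenever a simple linked net over $Q$ admits a configuration of one of these types, it is minimally $1$-generated, and minimally generated, by the collection of orange vertices of that configuration, of which there are two for types I, II, III and three for types IV, V. No simple linked net over $Q$ admits configurations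 of two different types. -/

import Mathlib

open CategoryTheory CategoryTheory.Limits

universe w v u

namespace LinkedNets

section Quivers

variable {V : Type u} [Quiver.{v + 1} V] {T : Type w} [DecidableEq T]

/-- The type of a path: the number of arrows of each type that it contains. -/
def typeCount (ty : ∀ ⦃x y : V⦄, (x ⟶ y) → T) : ∀ {x y : V}, Quiver.Path x y → T → ℕ
  | _, _, .nil => fun _ => 0
  | _, _, .cons p e => fun a => typeCount ty p a + if ty e = a then 1 else 0

/-- A path is admissible if it misses some arrow type. -/
def IsAdmissible (ty : ∀ ⦃x y : V⦄, (x ⟶ y) → T) {x y : V} (p : Quiver.Path x y) : Prop :=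
  ∃ a, typeCount ty p a = 0

/-- A path is simple if it contains at most one arrow of each type. -/
def IsSimplePath (ty : ∀ ⦃x y : V⦄, (x ⟶ y) → T) {x y : V} (p : Quiver.Path x y) : Prop :=
  ∀ a, typeCount ty p a ≤ 1

/-- A minimal circuit is a simple non-admissible path. -/
def IsMinimalCircuit (ty : ∀ ⦃x y : V⦄, (x ⟶ y) → T) {x y : V} (p : Quiver.Path x y) : Prop :=
  IsSimplePath ty p ∧ ¬ IsAdmissible ty p

/-- The quiver `V`, with its arrows partitioned into types by `ty`, is a `ℤⁿ`-quiver, where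
`n + 1` is the number of elements of `T`. -/
structure IsZnQuiver (ty : ∀ ⦃x y : V⦄, (x ⟶ y) → T) : Prop where
  nonempty : Nonempty V
  existsUnique_arrow : ∀ (x : V) (a : T), ∃! e : Quiver.Star x, ty e.2 = a
  exists_admissible : ∀ x y : V, ∃ p : Quiver.Path x y, IsAdmissible ty p
  target_eq_iff : ∀ (x y z : V) (p : Quiver.Path x y) (q : Quiver.Path x z),
    y = z ↔ ∃ c : ℤ, ∀ a, (typeCount ty p a : ℤ) - (typeCount ty q a : ℤ) = c

/-- Two distinct vertices connected by a simple path are neighbors. -/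
def IsNeighbor (ty : ∀ ⦃x y : V⦄, (x ⟶ y) → T) (x y : V) : Prop :=
  x ≠ y ∧ ∃ p : Quiver.Path x y, IsSimplePath ty p

end Quivers

section Representations

variable {V : Type u} [Quiver.{v + 1} V] {T : Type w} [DecidableEq T]
variable {C : Type*} [Category C]

/-- The composition of the maps of a representation along a path. -/
def pathMap (F : V ⥤q C) {x y : V} (p : Quiver.Path x y) : F.obj x ⟶ F.obj y :=
  composePath (F.mapPath p)

variable [Abelian C]

/-- A representation is simple if all its objects are simple. -/
def IsSimpleRep (F : V ⥤q C) : Prop :=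
  ∀ x, Simple (F.obj x)

/-- Conditions (1) and (2) below define weakly linked nets, and condition (3) linked nets. -/
structure IsLinkedNet (k : Type*) [Field k] [Linear k C]
    (ty : ∀ ⦃x y : V⦄, (x ⟶ y) → T) (F : V ⥤q C) : Prop where
  /-- (1) Maps along two paths with the same ends, the second one admissible. -/
  map_eq_smul : ∀ ⦃x y : V⦄ (p q : Quiver.Path x y), IsAdmissible ty q →
    ∃ c : k, pathMap F p = c • pathMap F q
  /-- (2) Minimal circuits induce zero. -/
  map_circuit : ∀ ⦃x y : V⦄ (p : Quiver.Path x y), IsMinimalCircuit ty p → pathMap F p = 0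
  /-- (3) Kernels along admissible paths with no arrow type in common intersect trivially. -/
  ker_inf_ker : ∀ ⦃x y z : V⦄ (p : Quiver.Path x y) (q : Quiver.Path x z),
    IsAdmissible ty p → IsAdmissible ty q →
    (∀ a, typeCount ty p a = 0 ∨ typeCount ty q a = 0) →
    kernelSubobject (pathMap F p) ⊓ kernelSubobject (pathMap F q) = ⊥

/-- For all neighbors `x`, `y`, the image of the map from `x` to `y` along admissible paths is the
kernel of the map from `y` to `x` along admissible paths. For linked nets, the choice of admissible
paths does not matter. -/
def IsExactRep (ty : ∀ ⦃x y : V⦄, (x ⟶ y) → T) (F : V ⥤q C) : Prop :=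
  ∀ ⦃x y : V⦄, IsNeighbor ty x y →
    ∀ (p : Quiver.Path x y) (q : Quiver.Path y x), IsAdmissible ty p → IsAdmissible ty q →
      imageSubobject (pathMap F p) = kernelSubobject (pathMap F q)

/-- For each vertex, all sufficiently long paths arriving at it induce zero. -/
def IsLocallyFinite (F : V ⥤q C) : Prop :=
  ∀ y : V, ∃ l : ℕ, ∀ (x : V) (p : Quiver.Path x y), l < p.length → pathMap F p = 0

/-- Each object is the target of an epimorphism along a path leaving a vertex of `H`. -/
def IsOneGenerated (F : V ⥤q C) (H : Set V) : Prop :=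
  ∀ y : V, ∃ x ∈ H, ∃ p : Quiver.Path x y, Epi (pathMap F p)

/-- Each object is the sum of the images along finitely many paths leaving vertices of `H`. -/
def IsGenerated (F : V ⥤q C) (H : Set V) : Prop :=
  ∀ y : V, ∃ s : Finset (Σ x : H, Quiver.Path (x : V) y),
    (s.sup fun p => imageSubobject (pathMap F p.2)) = ⊤

/-- `H` has the property `P`, and no smaller collection of vertices has it. -/
def IsMinimallyWith (P : Set V → Prop) (H : Set V) : Prop :=
  P H ∧ ∀ H' : Set V, H' ⊂ H → ¬ P H'

end Representations

section Configurations

/-- The direction of the arrows of each type in the plane, where `(X, Y)` stands for the point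
with Cartesian coordinates `(X * √3 / 2, Y / 2)`: type `0` goes from South-West to North-East,
type `1` from South-East to North-West, and type `2` from North to South. -/
def direction : Fin 3 → ℤ × ℤ
  | 0 => (1, 1)
  | 1 => (-1, 1)
  | 2 => (0, -2)

/-- `pos` represents a quiver with three arrow types as the standard planar one: its vertices are
identified with the points `(X, Y)` of the triangular lattice (`X + Y` odd), and each arrow goes in
the direction given by its type. -/
structure IsPlanarDrawing {V : Type u} [Quiver.{v + 1} V]
    (ty : ∀ ⦃x y : V⦄, (x ⟶ y) → Fin 3) (pos : V → ℤ × ℤ) : Prop where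
  injective : Function.Injective pos
  range_eq : Set.range pos = {p : ℤ × ℤ | Odd (p.1 + p.2)}
  arrow : ∀ ⦃x y : V⦄ (e : x ⟶ y), pos y = pos x + direction (ty e)

/-- The five types of configurations. -/
inductive ConfigType
  | I | II | III | IV | V

/-- The red arrows of each configuration. An arrow is given by its initial point and its type. -/
def ConfigType.red : ConfigType → List ((ℤ × ℤ) × Fin 3)
  | .I => [
      ((-2, 3), 0), ((-1, 2), 0), ((0, -3), 0), ((0, -1), 0), ((0, 1), 0),
      ((1, -2), 1), ((1, 0), 1), ((-1, 4), 2), ((0, 3), 2)]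
  | .II => [
      ((0, -3), 0), ((0, -1), 0), ((1, -4), 1), ((1, -2), 1), ((1, 0), 1),
      ((2, 1), 1), ((3, 2), 1), ((1, 2), 2), ((2, 3), 2)]
  | .III => [
      ((-2, 1), 0), ((-1, 0), 0), ((1, 0), 1), ((2, 1), 1), ((-2, 3), 2),
      ((-1, 2), 2), ((0, 1), 2), ((1, 2), 2), ((2, 3), 2)]
  | .IV => [
      ((-2, 3), 0), ((-1, 2), 0), ((0, -3), 0), ((0, -1), 0), ((0, 1), 0),
      ((1, -2), 1), ((1, 0), 1), ((1, 2), 1), ((2, 3), 1), ((3, 4), 1),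
      ((-2, 5), 2), ((-1, 4), 2), ((0, 3), 2), ((1, 4), 2), ((2, 5), 2)]
  | .V => [
      ((-2, 5), 0), ((-1, 4), 0), ((0, -1), 0), ((0, 1), 0), ((0, 3), 0),
      ((1, -2), 1), ((1, 0), 1), ((1, 2), 1), ((2, 3), 1), ((3, 4), 1),
      ((-1, 6), 2), ((0, 5), 2), ((1, 4), 2), ((2, 5), 2), ((3, 6), 2)]

/-- The blue arrows of each configuration. -/
def ConfigType.blue : ConfigType → List ((ℤ × ℤ) × Fin 3)
  | .I => [
      ((1, 2), 0), ((-1, 2), 1), ((0, 1), 1), ((0, 3), 1), ((1, 2), 1),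
      ((0, -1), 2), ((0, 1), 2), ((1, 0), 2), ((1, 2), 2)]
  | .II => [
      ((0, 1), 0), ((1, 0), 0), ((1, 2), 0), ((2, 1), 0), ((0, 1), 1),
      ((0, -1), 2), ((0, 1), 2), ((1, -2), 2), ((1, 0), 2)]
  | .III => [
      ((0, -1), 0), ((0, 1), 0), ((1, 0), 0), ((1, 2), 0), ((-1, 0), 1),
      ((-1, 2), 1), ((0, -1), 1), ((0, 1), 1), ((0, -1), 2)]
  | .IV => [
      ((0, 3), 0), ((1, 2), 0), ((1, 4), 0), ((2, 3), 0), ((-1, 2), 1),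
      ((-1, 4), 1), ((0, 1), 1), ((0, 3), 1), ((0, -1), 2), ((0, 1), 2),
      ((1, 0), 2), ((1, 2), 2)]
  | .V => [
      ((1, 2), 0), ((1, 4), 0), ((2, 3), 0), ((2, 5), 0), ((-1, 4), 1),
      ((0, 3), 1), ((0, 5), 1), ((1, 4), 1), ((0, 1), 2), ((0, 3), 2),
      ((1, 0), 2), ((1, 2), 2)]

/-- The orange vertices of each configuration. -/
def ConfigType.orange : ConfigType → Set (ℤ × ℤ)
  | .I => {(1, 2), (0, 1)}
  | .II => {(1, 0), (0, 1)}
  | .III => {(0, -1), (0, 1)}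
  | .IV => {(1, 2), (0, 1), (0, 3)}
  | .V => {(1, 2), (1, 4), (0, 3)}

/-- The number of orange vertices of each configuration. -/
def ConfigType.numOrange : ConfigType → ℕ
  | .I | .II | .III => 2
  | .IV | .V => 3

variable {V : Type u} [Quiver.{v + 1} V] {C : Type*} [Category C] [Abelian C]

/-- In the planar drawing `pos`, the red arrows of the type `t` correspond to zero maps and the
blue arrows to nonzero maps. -/
structure IsConfiguration (ty : ∀ ⦃x y : V⦄, (x ⟶ y) → Fin 3) (F : V ⥤q C)
    (t : ConfigType) (pos : V → ℤ × ℤ) : Prop where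
  drawing : IsPlanarDrawing ty pos
  red : ∀ ⦃x y : V⦄ (e : x ⟶ y), (pos x, ty e) ∈ t.red → F.map e = 0
  blue : ∀ ⦃x y : V⦄ (e : x ⟶ y), (pos x, ty e) ∈ t.blue → F.map e ≠ 0

/-- A representation admits a configuration of type `t` if it has one somewhere in the quiver. -/
def AdmitsConfiguration (ty : ∀ ⦃x y : V⦄, (x ⟶ y) → Fin 3) (F : V ⥤q C)
    (t : ConfigType) : Prop :=
  ∃ pos : V → ℤ × ℤ, IsConfiguration ty F t pos

/-- The vertices of the quiver drawn at the orange points. -/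
def orangeVertices (t : ConfigType) (pos : V → ℤ × ℤ) : Set V :=
  pos ⁻¹' t.orange

end Configurations

end LinkedNets

/-!
Since all objects are simple, every arrow of the net is zero or an isomorphism, so a path induces a
nonzero map exactly when all its arrows are nonzero, and the problem only concerns the positions of
the zero arrows. In a planar drawing, the vertices form a lattice `ℤ²` on which the arrows of types
`0`, `1`, `2` act by translations with sum `0`. Let `F a` be the set of lattice points from which
the arrow of type `a` is zero. The axioms of a linked net give (`isVanishingPattern`):

* the sets `F a` are pairwise disjoint, by condition (3);
* squares commute up to being zero, by condition (1);
* each minimal circuit contains a zero arrow, by condition (2).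

It follows that `F a` is closed under the steps of the two other types and has no inner corner
(`IsVanishingPattern.of_add_step_of_add_step`). Local finiteness makes every `F a` nonempty and, by
disjointness, bounded in the two directions in which it is closed. So `F a` is a full cone
(`IsVanishingPattern.exists_cone`), a sector of angle 120°. The circuits far from the apexes force
neighboring sectors to be adjacent or separated by a single line of vertices, and the squares near
the apexes then leave six relative positions (`IsVanishingPattern.cone_positions`). One of them,
where all three separating lines are present, is exact; the five others are the configurations.

Conversely, the red arrows of a configuration contain the apexes of three cones on which arrows
vanish. Inside the cone of type `a` the arrows of both other types are nonzero, and a nonzero arrow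
starts a ray of nonzero arrows of the same type; these two facts suffice to reach every vertex from
an orange one (`IsVanishingPattern.exists_orange_rel`). On the other hand no nonzero arrow arrives
at an orange vertex, so that the orange vertices are exactly the vertices with this property
(`mem_orangeVertices_iff`). This yields minimality, and shows that the set of orange vertices is
intrinsic. As drawings are unique up to translation and the five orange patterns are not translates
of each other, the type of the configuration is determined.
-/

namespace LinkedNets

/-! ### Vanishing patterns on the lattice -/

/-- The displacements of the arrows of the three types, in the lattice coordinates `(i, j)` standing
for the point `(i - j, i + j + 1)` of the planar drawing. -/
def latticeStep : Fin 3 → ℤ × ℤ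
  | 0 => (1, 0)
  | 1 => (0, 1)
  | 2 => (-1, -1)

lemma latticeStep_add_add : ∀ {a b c : Fin 3}, a ≠ b → a ≠ c → b ≠ c →
    latticeStep a + latticeStep b + latticeStep c = 0 := by
  decide

/-- The conditions that the linked net axioms impose on the positions of the zero arrows of a net
of simple objects; `Z a P` says that the arrow of type `a` leaving `P` is zero. -/
structure IsVanishingPattern (Z : Fin 3 → ℤ × ℤ → Prop) : Prop where
  disjoint : ∀ {a b P}, a ≠ b → Z a P → ¬ Z b P
  square : ∀ {a b P}, a ≠ b → Z a P ∨ Z b (P + latticeStep a) →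
    Z b P ∨ Z a (P + latticeStep b)
  circuit : ∀ {a b c P}, a ≠ b → a ≠ c → b ≠ c →
    Z a P ∨ Z b (P + latticeStep a) ∨ Z c (P + latticeStep a + latticeStep b)

namespace IsVanishingPattern

variable {Z : Fin 3 → ℤ × ℤ → Prop}

lemma add_step (hZ : IsVanishingPattern Z) {a b : Fin 3} {P : ℤ × ℤ} (hab : a ≠ b) (h : Z a P) :
    Z a (P + latticeStep b) :=
  (hZ.square hab (Or.inl h)).resolve_left (hZ.disjoint hab h)

/-- The set where the arrows of type `a` vanish has no inner corner: if it lacked `P`, then by the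
squares at `P` the arrows of both other types leaving `P + latticeStep a` would vanish. -/
lemma of_add_step_of_add_step (hZ : IsVanishingPattern Z) {a b c : Fin 3} {P : ℤ × ℤ}
    (hab : a ≠ b) (hac : a ≠ c) (hbc : b ≠ c)
    (hb : Z a (P + latticeStep b)) (hc : Z a (P + latticeStep c)) : Z a P := by
  by_contra h
  exact hZ.disjoint hbc ((hZ.square hab.symm (Or.inr hb)).resolve_left h)
    ((hZ.square hac.symm (Or.inr hc)).resolve_left h)

/-- If two consecutive arrows of type `a` had the first one nonzero and the second one zero, the
circuit starting after the first one would be nonzero. -/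
lemma of_add_step_self (hZ : IsVanishingPattern Z) {a : Fin 3} {P : ℤ × ℤ}
    (h : Z a (P + latticeStep a)) : Z a P := by
  obtain ⟨b, c, hab, hac, hbc⟩ : ∃ b c, a ≠ b ∧ a ≠ c ∧ b ≠ c := by
    have : ∀ a : Fin 3, ∃ b c, a ≠ b ∧ a ≠ c ∧ b ≠ c := by decide
    exact this a
  have key := hZ.circuit (P := P + latticeStep a) hbc hab.symm hac.symm
  rw [show P + latticeStep a + latticeStep b + latticeStep c = P by
    rw [add_assoc P, add_assoc P, latticeStep_add_add hab hac hbc, add_zero]] at key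
  exact (key.resolve_left (hZ.disjoint hab h)).resolve_left
    (hZ.disjoint hac (hZ.add_step hab h))

lemma add_nsmul (hZ : IsVanishingPattern Z) {a b c : Fin 3} {P : ℤ × ℤ} (hab : a ≠ b)
    (hac : a ≠ c) (h : Z a P) (m n : ℕ) :
    Z a (P + m • latticeStep b + n • latticeStep c) := by
  induction n with
  | zero =>
    rw [zero_nsmul, add_zero]
    induction m with
    | zero => rwa [zero_nsmul, add_zero]
    | succ m ih =>
      rw [succ_nsmul, ← add_assoc]
      exact hZ.add_step hab ih
  | succ n ih =>
    rw [succ_nsmul, ← add_assoc]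
    exact hZ.add_step hac ih

lemma eq_add_nsmul_zero {i₀ j₀ i j : ℤ} (h₁ : i ≤ i₀) (h₂ : j₀ - i₀ ≤ j - i) :
    ((i, j) : ℤ × ℤ) = (i₀, j₀) + (j - i - (j₀ - i₀)).toNat • latticeStep 1 +
      (i₀ - i).toNat • latticeStep 2 := by
  ext <;> simp [latticeStep] <;> omega

lemma eq_add_nsmul_one {i₀ j₀ i j : ℤ} (h₁ : j ≤ j₀) (h₂ : i₀ - j₀ ≤ i - j) :
    ((i, j) : ℤ × ℤ) = (i₀, j₀) + (i - j - (i₀ - j₀)).toNat • latticeStep 0 +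
      (j₀ - j).toNat • latticeStep 2 := by
  ext <;> simp [latticeStep] <;> omega

lemma eq_add_nsmul_two {i₀ j₀ i j : ℤ} (h₁ : i₀ ≤ i) (h₂ : j₀ ≤ j) :
    ((i, j) : ℤ × ℤ) = (i₀, j₀) + (i - i₀).toNat • latticeStep 0 +
      (j - j₀).toNat • latticeStep 1 := by
  ext <;> simp [latticeStep] <;> omega

lemma zero_of_le (hZ : IsVanishingPattern Z) {i₀ j₀ i j : ℤ} (h : Z 0 (i₀, j₀)) (h₁ : i ≤ i₀)
    (h₂ : j₀ - i₀ ≤ j - i) : Z 0 (i, j) := by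
  rw [eq_add_nsmul_zero h₁ h₂]
  exact hZ.add_nsmul (by decide) (by decide) h _ _

lemma one_of_le (hZ : IsVanishingPattern Z) {i₀ j₀ i j : ℤ} (h : Z 1 (i₀, j₀)) (h₁ : j ≤ j₀)
    (h₂ : i₀ - j₀ ≤ i - j) : Z 1 (i, j) := by
  rw [eq_add_nsmul_one h₁ h₂]
  exact hZ.add_nsmul (by decide) (by decide) h _ _

lemma two_of_le (hZ : IsVanishingPattern Z) {i₀ j₀ i j : ℤ} (h : Z 2 (i₀, j₀)) (h₁ : i₀ ≤ i)
    (h₂ : j₀ ≤ j) : Z 2 (i, j) := by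
  rw [eq_add_nsmul_two h₁ h₂]
  exact hZ.add_nsmul (by decide) (by decide) h _ _

end IsVanishingPattern

/-! ### The zero arrows of each type form a cone -/

/-- An up-closed subset of the plane that has no inner corner and is bounded below along every
horizontal and vertical line is a quadrant. -/
lemma exists_eq_quadrant {U : ℤ → ℤ → Prop} (hx : ∀ x y, U x y → U (x + 1) y)
    (hy : ∀ x y, U x y → U x (y + 1)) (hc : ∀ x y, U (x + 1) y → U x (y + 1) → U x y)
    (hne : ∃ x y, U x y) (hbx : ∀ x y, ∃ n : ℕ, ¬ U (x - n) y)
    (hby : ∀ x y, ∃ n : ℕ, ¬ U x (y - n)) :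
    ∃ x₀ y₀, ∀ x y, U x y ↔ x₀ ≤ x ∧ y₀ ≤ y := by
  have hxn : ∀ x x' y, x ≤ x' → U x y → U x' y := fun x x' y h hU =>
    Int.leInduction hU (fun n _ ih => hx n y ih) x' h
  have hyn : ∀ x y y', y ≤ y' → U x y → U x y' := fun x y y' h hU =>
    Int.leInduction hU (fun n _ ih => hy x n ih) y' h
  -- Having no inner corner propagates: first for steps of width one, then `U` contains the lower
  -- left corner of each rectangle whose two adjacent corners it contains.
  have hc₁ : ∀ x y y', y ≤ y' → U (x + 1) y → U x y' → U x y := fun x y y' h h₁ h₂ => by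
    induction y', h using Int.leInduction with
    | base => exact h₂
    | succ n hn ih => exact ih (hc x n (hyn _ _ _ hn h₁) h₂)
  have hc₂ : ∀ x x' y y', x ≤ x' → y ≤ y' → U x' y → U x y' → U x y :=
    fun x x' y y' h h' h₁ h₂ => by
    induction x', h using Int.leInduction with
    | base => exact h₁
    | succ n hn ih => exact ih (hc₁ n y y' h' h₁ (hxn _ _ _ hn h₂))
  obtain ⟨x₁, y₁, h₁⟩ := hne
  obtain ⟨x₀, hx₀, hx₀'⟩ : ∃ x₀, U x₀ y₁ ∧ ∀ x, U x y₁ → x₀ ≤ x := by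
    obtain ⟨n, hn⟩ := hbx x₁ y₁
    exact Int.exists_least_of_bdd ⟨x₁ - n, fun x h => by
      by_contra hlt
      exact hn (hxn x _ _ (by omega) h)⟩ ⟨x₁, h₁⟩
  obtain ⟨y₀, hy₀, hy₀'⟩ : ∃ y₀, U x₁ y₀ ∧ ∀ y, U x₁ y → y₀ ≤ y := by
    obtain ⟨n, hn⟩ := hby x₁ y₁
    exact Int.exists_least_of_bdd ⟨y₁ - n, fun y h => by
      by_contra hlt
      exact hn (hyn _ y _ (by omega) h)⟩ ⟨y₁, h₁⟩
  refine ⟨x₀, y₀, fun x y => ⟨fun h => ⟨?_, ?_⟩, fun h => ?_⟩⟩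
  · by_contra hlt
    exact hlt (hx₀' x (hc₂ x x₀ y₁ (max y y₁) (by omega) (by omega) hx₀ (hyn _ _ _ (by omega) h)))
  · by_contra hlt
    exact hlt (hy₀' y (hc₂ x₁ (max x x₁) y y₀ (by omega) (by omega) (hxn _ _ _ (by omega) h) hy₀))
  · exact hxn x₀ _ _ h.1 (hyn _ y₀ _ h.2
      (hc₂ x₀ x₁ y₀ y₁ (hx₀' _ h₁) (hy₀' _ h₁) hy₀ hx₀))

namespace IsVanishingPattern

variable {Z : Fin 3 → ℤ × ℤ → Prop}

/-- Under local finiteness the arrows of each type vanish exactly on a cone. -/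
lemma exists_cone (hZ : IsVanishingPattern Z)
    (hf : ∀ a P, ∃ n : ℕ, Z a (P - n • latticeStep a)) {a b c : Fin 3} (hab : a ≠ b) (hac : a ≠ c)
    (hbc : b ≠ c) : ∃ x₀ y₀ : ℤ, ∀ x y : ℤ,
      Z a (x • latticeStep b + y • latticeStep c) ↔ x₀ ≤ x ∧ y₀ ≤ y := by
  have e₁ : ∀ x y : ℤ, (x + 1) • latticeStep b + y • latticeStep c =
      x • latticeStep b + y • latticeStep c + latticeStep b := fun x y => by
    rw [add_smul, one_smul]; abel
  have e₂ : ∀ x y : ℤ, x • latticeStep b + (y + 1) • latticeStep c =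
      x • latticeStep b + y • latticeStep c + latticeStep c := fun x y => by
    rw [add_smul, one_smul]; abel
  refine exists_eq_quadrant (U := fun x y => Z a (x • latticeStep b + y • latticeStep c))
    (fun x y h => e₁ x y ▸ hZ.add_step hab h) (fun x y h => e₂ x y ▸ hZ.add_step hac h)
    (fun x y h₁ h₂ => hZ.of_add_step_of_add_step hab hac hbc (e₁ x y ▸ h₁) (e₂ x y ▸ h₂))
    ?_ ?_ ?_
  · obtain ⟨n, hn⟩ := hf a 0
    refine ⟨n, n, ?_⟩
    convert hn using 1
    rw [eq_sub_iff_add_eq, ← natCast_zsmul, ← smul_add, ← smul_add, add_comm, ← add_assoc,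
      latticeStep_add_add hab hac hbc,
      smul_zero]
  -- Going backwards along the type `b` one meets points where `b` vanishes, hence `a` does not.
  · intro x y
    obtain ⟨n, hn⟩ := hf b (x • latticeStep b + y • latticeStep c)
    refine ⟨n, fun h => hZ.disjoint hab h ?_⟩
    convert hn using 1
    rw [sub_smul, natCast_zsmul]; abel
  · intro x y
    obtain ⟨n, hn⟩ := hf c (x • latticeStep b + y • latticeStep c)
    refine ⟨n, fun h => hZ.disjoint hac h ?_⟩
    convert hn using 1
    rw [sub_smul, natCast_zsmul]; abel

/-- The three cones in lattice coordinates. -/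
lemma exists_cones (hZ : IsVanishingPattern Z)
    (hf : ∀ a P, ∃ n : ℕ, Z a (P - n • latticeStep a)) :
    ∃ α₀ β₀ α₁ β₁ α₂ β₂ : ℤ, (∀ i j, Z 0 (i, j) ↔ i ≤ α₀ ∧ β₀ ≤ j - i) ∧
      (∀ i j, Z 1 (i, j) ↔ j ≤ α₁ ∧ j - i ≤ β₁) ∧ (∀ i j, Z 2 (i, j) ↔ α₂ ≤ i ∧ β₂ ≤ j) := by
  obtain ⟨x₀, y₀, h₀⟩ := hZ.exists_cone hf (a := 0) (b := 1) (c := 2)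
    (by decide) (by decide) (by decide)
  obtain ⟨x₁, y₁, h₁⟩ := hZ.exists_cone hf (a := 1) (b := 0) (c := 2)
    (by decide) (by decide) (by decide)
  obtain ⟨x₂, y₂, h₂⟩ := hZ.exists_cone hf (a := 2) (b := 0) (c := 1)
    (by decide) (by decide) (by decide)
  refine ⟨-y₀, x₀, -y₁, -x₁, x₂, y₂, fun i j => ?_, fun i j => ?_, fun i j => ?_⟩
  · rw [show ((i, j) : ℤ × ℤ) = (j - i) • latticeStep 1 + (-i) • latticeStep 2 by
      ext <;> simp [latticeStep], h₀]
    omega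
  · rw [show ((i, j) : ℤ × ℤ) = (i - j) • latticeStep 0 + (-j) • latticeStep 2 by
      ext <;> simp [latticeStep], h₁]
    omega
  · rw [show ((i, j) : ℤ × ℤ) = i • latticeStep 0 + j • latticeStep 1 by
      ext <;> simp [latticeStep], h₂]

/-! ### The relative positions of the three cones -/

/-- Two neighboring cones are separated by one or two steps: they are disjoint, and the circuits
far away from the apexes of the cones leave no wider gap. -/
lemma cone_gaps (hZ : IsVanishingPattern Z) {α₀ β₀ α₁ β₁ α₂ β₂ : ℤ}
    (h₀ : ∀ i j, Z 0 (i, j) ↔ i ≤ α₀ ∧ β₀ ≤ j - i)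
    (h₁ : ∀ i j, Z 1 (i, j) ↔ j ≤ α₁ ∧ j - i ≤ β₁)
    (h₂ : ∀ i j, Z 2 (i, j) ↔ α₂ ≤ i ∧ β₂ ≤ j) :
    (β₀ - β₁ = 1 ∨ β₀ - β₁ = 2) ∧ (α₂ - α₀ = 1 ∨ α₂ - α₀ = 2) ∧
      (β₂ - α₁ = 1 ∨ β₂ - α₁ = 2) := by
  have D := fun i j => hZ.disjoint (a := 0) (b := 1) (P := (i, j)) (by decide)
  have D' := fun i j => hZ.disjoint (a := 0) (b := 2) (P := (i, j)) (by decide)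
  have D'' := fun i j => hZ.disjoint (a := 1) (b := 2) (P := (i, j)) (by decide)
  have K := fun i j => hZ.circuit (a := 0) (b := 1) (c := 2) (P := (i, j))
    (by decide) (by decide) (by decide)
  have K' := fun i j => hZ.circuit (a := 0) (b := 2) (c := 1) (P := (i, j))
    (by decide) (by decide) (by decide)
  have K'' := fun i j => hZ.circuit (a := 1) (b := 2) (c := 0) (P := (i, j))
    (by decide) (by decide) (by decide)
  simp only [latticeStep, Prod.mk_add_mk, h₀, h₁, h₂] at D D' D'' K K' K''
  -- A bound beyond which only the two cones in question matter.
  obtain ⟨N, hN⟩ : ∃ N : ℤ, |α₀| ≤ N ∧ |α₁| ≤ N ∧ |α₂| ≤ N ∧ |β₀| ≤ N ∧ |β₁| ≤ N ∧ |β₂| ≤ N :=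
    ⟨|α₀| + |α₁| + |α₂| + |β₀| + |β₁| + |β₂|, by
      refine ⟨?_, ?_, ?_, ?_, ?_, ?_⟩ <;> linarith [abs_nonneg α₀, abs_nonneg α₁, abs_nonneg α₂,
        abs_nonneg β₀, abs_nonneg β₁, abs_nonneg β₂]⟩
  simp only [abs_le] at hN
  refine ⟨?_, ?_, ?_⟩
  · have := D (-5 * N - 10) (β₀ - 5 * N - 10)
    have := K (-5 * N - 10) (β₁ + 1 - 5 * N - 10)
    have := K (-5 * N - 10) (β₀ - 1 - 5 * N - 10)
    omega
  · have := D' α₀ (5 * N + 10)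
    have := K' (α₀ + 1) (5 * N + 10)
    omega
  · have := D'' (5 * N + 10) α₁
    have := K'' (5 * N + 10) (α₁ + 1)
    omega

/-- The six possible relative positions of the three cones. Those of the configurations I to V are
followed by the one in which every two cones are separated by a line of vertices. -/
lemma cone_positions (hZ : IsVanishingPattern Z) {α₀ β₀ α₁ β₁ α₂ β₂ : ℤ}
    (h₀ : ∀ i j, Z 0 (i, j) ↔ i ≤ α₀ ∧ β₀ ≤ j - i)
    (h₁ : ∀ i j, Z 1 (i, j) ↔ j ≤ α₁ ∧ j - i ≤ β₁)
    (h₂ : ∀ i j, Z 2 (i, j) ↔ α₂ ≤ i ∧ β₂ ≤ j) :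
    (β₁ = β₀ - 1 ∧ α₂ = α₀ + 1 ∧ β₂ = α₁ + 2 ∧ α₁ = α₀ + β₀ - 1) ∨
    (β₁ = β₀ - 1 ∧ α₂ = α₀ + 2 ∧ β₂ = α₁ + 1 ∧ α₁ = α₀ + β₀) ∨
    (β₁ = β₀ - 2 ∧ α₂ = α₀ + 1 ∧ β₂ = α₁ + 1 ∧ α₁ = α₀ + β₀ - 1) ∨
    (β₁ = β₀ - 1 ∧ α₂ = α₀ + 1 ∧ β₂ = α₁ + 1 ∧ α₁ = α₀ + β₀) ∨
    (β₁ = β₀ - 1 ∧ α₂ = α₀ + 1 ∧ β₂ = α₁ + 1 ∧ α₁ = α₀ + β₀ - 1) ∨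
    (β₁ = β₀ - 2 ∧ α₂ = α₀ + 2 ∧ β₂ = α₁ + 2 ∧ α₁ = α₀ + β₀ - 1) := by
  have gaps := hZ.cone_gaps h₀ h₁ h₂
  have C : ∀ a b P, a ≠ b → (Z a P ∨ Z b (P + latticeStep a) ↔
      Z b P ∨ Z a (P + latticeStep b)) := fun a b P hab =>
    ⟨hZ.square hab, hZ.square hab.symm⟩
  have C₁ := fun i j => C 0 1 (i, j) (by decide)
  have C₂ := fun i j => C 0 2 (i, j) (by decide)
  have C₃ := fun i j => C 1 2 (i, j) (by decide)
  simp only [latticeStep, Prod.mk_add_mk, h₀, h₁, h₂] at C₁ C₂ C₃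
  -- The squares near the apexes of the cones fix the remaining parameter.
  have e₁ := C₁ (α₁ - β₀ + 2) (α₁ + 1)
  have e₂ := C₁ (α₀ + 1) (α₀ + β₀)
  have e₃ := C₁ (α₀ + 1) (α₀ + β₀ + 1)
  have e₄ := C₂ (α₀ + 1) (α₀ + β₀)
  have e₅ := C₂ (α₀ + 1) (α₀ + β₀ + 1)
  have e₆ := C₃ (α₀ + 1) (α₀ + β₀)
  clear C₁ C₂ C₃ C h₀ h₁ h₂
  have lo : α₀ + β₀ - 1 ≤ α₁ := by clear e₂ e₃ e₄ e₅ e₆; omega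
  have hi : α₁ ≤ α₀ + β₀ := by clear e₁ e₄ e₅ e₆; omega
  clear e₁
  obtain ⟨g₁ | g₁, g₂ | g₂, g₃ | g₃⟩ := gaps <;>
    obtain rfl | rfl : α₁ = α₀ + β₀ - 1 ∨ α₁ = α₀ + β₀ := by omega
  all_goals
    obtain rfl : β₀ = _ := sub_eq_iff_eq_add'.1 g₁
    obtain rfl : α₂ = _ := sub_eq_iff_eq_add'.1 g₂
    obtain rfl : β₂ = _ := sub_eq_iff_eq_add'.1 g₃
    -- In each case at most one of the squares is needed.
    first
    | (clear e₂ e₃ e₄ e₅ e₆; omega)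
    | (exfalso; clear e₃ e₄ e₅ e₆; omega)
    | (exfalso; clear e₂ e₃ e₅ e₆; omega)
    | (exfalso; clear e₂ e₃ e₄ e₆; omega)
    | (exfalso; clear e₂ e₃ e₄ e₅; omega)

/-- A locally finite pattern in which some neighbors are connected by zero maps in both directions
(hypothesis `hne`) contains one of the five configurations. The translation `τ` moves the apex of
the cone of type `0` to its place in the configuration. -/
lemma exists_configType (hZ : IsVanishingPattern Z)
    (hf : ∀ a P, ∃ n : ℕ, Z a (P - n • latticeStep a))
    (hne : ∃ a b c P, a ≠ b ∧ a ≠ c ∧ b ≠ c ∧ Z a P ∧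
      (Z b (P + latticeStep a) ∨ Z c (P + latticeStep a + latticeStep b))) :
    ∃ (t : ConfigType) (τ : ℤ × ℤ), Even (τ.1 + τ.2) ∧ ∀ a i j,
      (((i - j + τ.1, i + j + 1 + τ.2), a) ∈ t.red → Z a (i, j)) ∧
      (((i - j + τ.1, i + j + 1 + τ.2), a) ∈ t.blue → ¬ Z a (i, j)) := by
  obtain ⟨α₀, β₀, α₁, β₁, α₂, β₂, h₀, h₁, h₂⟩ := hZ.exists_cones hf
  obtain h | h | h | h | h | h := hZ.cone_positions h₀ h₁ h₂
  · refine ⟨.I, (β₀, -2 * α₀ - β₀), ⟨-α₀, by ring⟩, fun a i j => ?_⟩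
    fin_cases a <;>
      simp [ConfigType.red, ConfigType.blue, h₀, h₁, h₂] <;> omega
  · refine ⟨.II, (β₀, -2 - 2 * α₀ - β₀), ⟨-1 - α₀, by ring⟩, fun a i j => ?_⟩
    fin_cases a <;>
      simp [ConfigType.red, ConfigType.blue, h₀, h₁, h₂] <;> omega
  · refine ⟨.III, (β₀ - 1, -1 - 2 * α₀ - β₀), ⟨-1 - α₀, by ring⟩, fun a i j => ?_⟩
    fin_cases a <;>
      simp [ConfigType.red, ConfigType.blue, h₀, h₁, h₂] <;> omega
  · refine ⟨.IV, (β₀, -2 * α₀ - β₀), ⟨-α₀, by ring⟩, fun a i j => ?_⟩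
    fin_cases a <;>
      simp [ConfigType.red, ConfigType.blue, h₀, h₁, h₂] <;> omega
  · refine ⟨.V, (β₀, 2 - 2 * α₀ - β₀), ⟨1 - α₀, by ring⟩, fun a i j => ?_⟩
    fin_cases a <;>
      simp [ConfigType.red, ConfigType.blue, h₀, h₁, h₂] <;> omega
  -- In the last case the net is generated by a single vertex, and is exact.
  · exfalso
    obtain ⟨a, b, c, ⟨i, j⟩, hab, hac, hbc, hP⟩ := hne
    fin_cases a <;> fin_cases b <;> try (exact absurd rfl hab)
    all_goals fin_cases c <;> first
      | exact absurd rfl hac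
      | exact absurd rfl hbc
      | (simp [latticeStep, h₀, h₁, h₂] at hP; omega)

/-! ### Generation along nonzero arrows -/

section Relation

variable {R : ℤ × ℤ → ℤ × ℤ → Prop} (hstep : ∀ a O P, R O P → ¬ Z a P → R O (P + latticeStep a))
include hstep

/-- Inside the cone where the arrows of type `a` vanish, those of the other types do not, by
disjointness; so the whole cone is reached from its apex. -/
lemma rel_add_nsmul (hZ : IsVanishingPattern Z) {a b c : Fin 3} {O P : ℤ × ℤ} (hab : a ≠ b)
    (hac : a ≠ c) (h : Z a P) (hR : R O P) (m n : ℕ) :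
    R O (P + m • latticeStep b + n • latticeStep c) := by
  induction n with
  | zero =>
    induction m with
    | zero => simpa using hR
    | succ m ih =>
      rw [zero_nsmul, add_zero] at ih ⊢
      rw [succ_nsmul, ← add_assoc]
      exact hstep _ _ _ ih (hZ.disjoint hab (by simpa using hZ.add_nsmul hab hac h m 0))
  | succ n ih =>
    rw [succ_nsmul, ← add_assoc]
    exact hstep _ _ _ ih (hZ.disjoint hac (hZ.add_nsmul hab hac h m n))

lemma rel_zero (hZ : IsVanishingPattern Z) {O : ℤ × ℤ} {i₀ j₀ i j : ℤ} (h : Z 0 (i₀, j₀))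
    (hR : R O (i₀, j₀)) (h₁ : i ≤ i₀) (h₂ : j₀ - i₀ ≤ j - i) : R O (i, j) := by
  rw [eq_add_nsmul_zero h₁ h₂]
  exact rel_add_nsmul hstep hZ (by decide) (by decide) h hR _ _

lemma rel_one (hZ : IsVanishingPattern Z) {O : ℤ × ℤ} {i₀ j₀ i j : ℤ} (h : Z 1 (i₀, j₀))
    (hR : R O (i₀, j₀)) (h₁ : j ≤ j₀) (h₂ : i₀ - j₀ ≤ i - j) : R O (i, j) := by
  rw [eq_add_nsmul_one h₁ h₂]
  exact rel_add_nsmul hstep hZ (by decide) (by decide) h hR _ _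

lemma rel_two (hZ : IsVanishingPattern Z) {O : ℤ × ℤ} {i₀ j₀ i j : ℤ} (h : Z 2 (i₀, j₀))
    (hR : R O (i₀, j₀)) (h₁ : i₀ ≤ i) (h₂ : j₀ ≤ j) : R O (i, j) := by
  rw [eq_add_nsmul_two h₁ h₂]
  exact rel_add_nsmul hstep hZ (by decide) (by decide) h hR _ _

/-- An arrow that is nonzero starts a ray of nonzero arrows of its type. -/
lemma rel_ray (hZ : IsVanishingPattern Z) {a : Fin 3} {O P : ℤ × ℤ} (h : ¬ Z a P)
    (hR : R O P) (n : ℕ) : R O (P + n • latticeStep a) := by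
  have hn : ∀ n : ℕ, ¬ Z a (P + n • latticeStep a) := fun n => by
    induction n with
    | zero => simpa using h
    | succ n ih =>
      rw [succ_nsmul, ← add_assoc]
      exact fun h' => ih (hZ.of_add_step_self h')
  induction n with
  | zero => simpa using hR
  | succ n ih =>
    rw [succ_nsmul, ← add_assoc]
    exact hstep _ _ _ ih (hn n)

end Relation

end IsVanishingPattern

/-- The lattice coordinates of the apex of the cone of zero arrows of each type, for a configuration
drawn at its standard place. -/
def ConfigType.apex : ConfigType → Fin 3 → ℤ × ℤ
  | .I => ![(0, 0), (0, -1), (1, 1)]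
  | .II => ![(-1, -1), (0, -1), (1, 0)]
  | .III => ![(-1, 0), (0, -1), (0, 0)]
  | .IV => ![(0, 0), (1, 0), (1, 1)]
  | .V => ![(1, 1), (1, 0), (2, 1)]

lemma ConfigType.apex_mem_red (t : ConfigType) (a : Fin 3) :
    (((t.apex a).1 - (t.apex a).2, (t.apex a).1 + (t.apex a).2 + 1), a) ∈ t.red := by
  cases t <;> revert a <;> decide

namespace IsVanishingPattern

variable {Z : Fin 3 → ℤ × ℤ → Prop} {t : ConfigType}

/-- All arrows arriving at an orange vertex are zero. -/
lemma of_mem_orange (hZ : IsVanishingPattern Z)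
    (hred : ∀ a i j, ((i - j, i + j + 1), a) ∈ t.red → Z a (i, j)) (a : Fin 3) (i j : ℤ)
    (h : (i - j, i + j + 1) ∈ t.orange) : Z a ((i, j) - latticeStep a) := by
  have hapex : ∀ a, Z a (t.apex a) := fun a => hred _ _ _ (t.apex_mem_red a)
  have h₀ := fun i j => hZ.zero_of_le (i := i) (j := j) (hapex 0)
  have h₁ := fun i j => hZ.one_of_le (i := i) (j := j) (hapex 1)
  have h₂ := fun i j => hZ.two_of_le (i := i) (j := j) (hapex 2)
  cases t <;> simp [ConfigType.orange] at h h₀ h₁ h₂ <;> fin_cases a <;>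
    first
    | exact h₀ _ _ (by dsimp [latticeStep]; omega) (by dsimp [latticeStep]; omega)
    | exact h₁ _ _ (by dsimp [latticeStep]; omega) (by dsimp [latticeStep]; omega)
    | exact h₂ _ _ (by dsimp [latticeStep]; omega) (by dsimp [latticeStep]; omega)

/-- Every vertex can be reached from an orange vertex along nonzero arrows. Here `R` is any relation
containing the one of being connected by nonzero arrows. -/
lemma exists_orange_rel (hZ : IsVanishingPattern Z)
    (hred : ∀ a i j, ((i - j, i + j + 1), a) ∈ t.red → Z a (i, j))
    (hblue : ∀ a i j, ((i - j, i + j + 1), a) ∈ t.blue → ¬ Z a (i, j))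
    {R : ℤ × ℤ → ℤ × ℤ → Prop} (hrefl : ∀ P, R P P)
    (hstep : ∀ a P Q, R P Q → ¬ Z a Q → R P (Q + latticeStep a)) (i j : ℤ) :
    ∃ i' j' : ℤ, (i' - j', i' + j' + 1) ∈ t.orange ∧ R (i', j') (i, j) := by
  have hapex : ∀ a, Z a (t.apex a) := fun a => hred _ _ _ (t.apex_mem_red a)
  have r₀ := fun O i j => rel_zero hstep hZ (O := O) (i := i) (j := j) (hapex 0)
  have r₁ := fun O i j => rel_one hstep hZ (O := O) (i := i) (j := j) (hapex 1)
  have r₂ := fun O i j => rel_two hstep hZ (O := O) (i := i) (j := j) (hapex 2)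
  -- The three cones cover the lattice up to a ray for the types I to III. There, one orange vertex
  -- is the apex of a cone; the other one is the origin of the ray, and a single step leads from it to
  -- the apexes of the two other cones. For the types IV and V each orange vertex is an apex.
  cases t
  case I =>
    have s₀ := rel_ray hstep hZ (hblue 0 1 0 (by decide)) (hrefl _)
    have s₁ := hstep 1 _ _ (hrefl (1, 0)) (hblue 1 1 0 (by decide))
    have s₂ := hstep 2 _ _ (hrefl (1, 0)) (hblue 2 1 0 (by decide))
    obtain h | h | h | h : (i ≤ 0 ∧ i ≤ j) ∨ (1 ≤ i ∧ j = 0) ∨ (1 ≤ i ∧ 1 ≤ j) ∨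
      (j ≤ -1 ∧ 1 ≤ i - j) := by omega
    · exact ⟨0, 0, by simp [ConfigType.orange], r₀ _ i j (hrefl _) h.1 (by simp; omega)⟩
    · refine ⟨1, 0, by simp [ConfigType.orange], ?_⟩
      convert s₀ (i - 1).toNat using 1
      ext <;> simp [latticeStep] <;> omega
    · exact ⟨1, 0, by simp [ConfigType.orange], r₂ _ i j s₁ h.1 h.2⟩
    · exact ⟨1, 0, by simp [ConfigType.orange], r₁ _ i j s₂ h.1 h.2⟩
  case II =>
    have s₁ := rel_ray hstep hZ (hblue 1 0 0 (by decide)) (hrefl _)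
    have s₀ := hstep 0 _ _ (hrefl (0, 0)) (hblue 0 0 0 (by decide))
    have s₂ := hstep 2 _ _ (hrefl (0, 0)) (hblue 2 0 0 (by decide))
    obtain h | h | h | h : (j ≤ -1 ∧ 1 ≤ i - j) ∨ (i = 0 ∧ 0 ≤ j) ∨ (1 ≤ i ∧ 0 ≤ j) ∨
      (i ≤ -1 ∧ i ≤ j) := by omega
    · exact ⟨0, -1, by simp [ConfigType.orange], r₁ _ i j (hrefl _) h.1 h.2⟩
    · refine ⟨0, 0, by simp [ConfigType.orange], ?_⟩
      convert s₁ j.toNat using 1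
      ext <;> simp [latticeStep] <;> omega
    · exact ⟨0, 0, by simp [ConfigType.orange], r₂ _ i j s₀ h.1 h.2⟩
    · exact ⟨0, 0, by simp [ConfigType.orange], r₀ _ i j s₂ h.1 (by simp; omega)⟩
  case III =>
    have s₂ := rel_ray hstep hZ (hblue 2 (-1) (-1) (by decide)) (hrefl _)
    have s₀ := hstep 0 _ _ (hrefl (-1, -1)) (hblue 0 (-1) (-1) (by decide))
    have s₁ := hstep 1 _ _ (hrefl (-1, -1)) (hblue 1 (-1) (-1) (by decide))
    obtain h | h | h | h : (0 ≤ i ∧ 0 ≤ j) ∨ (i ≤ -1 ∧ j = i) ∨ (j ≤ -1 ∧ 1 ≤ i - j) ∨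
      (i ≤ -1 ∧ 1 ≤ j - i) := by omega
    · exact ⟨0, 0, by simp [ConfigType.orange], r₂ _ i j (hrefl _) h.1 h.2⟩
    · refine ⟨-1, -1, by simp [ConfigType.orange], ?_⟩
      convert s₂ (-1 - i).toNat using 1
      ext <;> simp [latticeStep] <;> omega
    · exact ⟨-1, -1, by simp [ConfigType.orange], r₁ _ i j s₀ h.1 h.2⟩
    · exact ⟨-1, -1, by simp [ConfigType.orange], r₀ _ i j s₁ h.1 h.2⟩
  case IV =>
    obtain h | h | h : (i ≤ 0 ∧ i ≤ j) ∨ (j ≤ 0 ∧ 1 ≤ i - j) ∨ (1 ≤ i ∧ 1 ≤ j) := by omega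
    · exact ⟨0, 0, by simp [ConfigType.orange], r₀ _ i j (hrefl _) h.1 (by simp; omega)⟩
    · exact ⟨1, 0, by simp [ConfigType.orange], r₁ _ i j (hrefl _) h.1 h.2⟩
    · exact ⟨1, 1, by simp [ConfigType.orange], r₂ _ i j (hrefl _) h.1 h.2⟩
  case V =>
    obtain h | h | h : (i ≤ 1 ∧ i ≤ j) ∨ (j ≤ 0 ∧ 1 ≤ i - j) ∨ (2 ≤ i ∧ 1 ≤ j) := by omega
    · exact ⟨1, 1, by simp [ConfigType.orange], r₀ _ i j (hrefl _) h.1 (by simp; omega)⟩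
    · exact ⟨1, 0, by simp [ConfigType.orange], r₁ _ i j (hrefl _) h.1 h.2⟩
    · exact ⟨2, 1, by simp [ConfigType.orange], r₂ _ i j (hrefl _) h.1 h.2⟩

end IsVanishingPattern

/-! ### Planar drawings -/

section Drawings

variable {V : Type u} [Quiver.{v + 1} V] {ty : ∀ ⦃x y : V⦄, (x ⟶ y) → Fin 3}

/-- The total displacement along a path with `n a` arrows of each type `a`. -/
def displacement (n : Fin 3 → ℤ) : ℤ × ℤ :=
  (n 0 - n 1, n 0 + n 1 - 2 * n 2)

lemma displacement_add_single (n : Fin 3 → ℤ) (b : Fin 3) :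
    displacement (fun a => n a + if b = a then 1 else 0) = displacement n + direction b := by
  fin_cases b <;> ext <;> simp [displacement, direction] <;> ring

/-- Displacements coincide exactly when condition (iii) of a `ℤ²`-quiver makes the targets
coincide. -/
lemma displacement_eq_iff (m n : Fin 3 → ℤ) :
    displacement m = displacement n ↔ ∃ c : ℤ, ∀ a, m a - n a = c := by
  simp only [displacement, Prod.mk.injEq, Fin.forall_fin_succ, Fin.isValue, Fin.succ_zero_eq_one,
    Fin.succ_one_eq_two, IsEmpty.forall_iff, and_true]
  constructor
  · rintro ⟨h₁, h₂⟩
    exact ⟨m 0 - n 0, by omega, by omega⟩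
  · rintro ⟨c, h⟩
    omega

lemma IsPlanarDrawing.pos_eq_add {pos : V → ℤ × ℤ} (hpos : IsPlanarDrawing ty pos) {x y : V}
    (p : Quiver.Path x y) : pos y = pos x + displacement fun a => typeCount ty p a := by
  induction p with
  | nil => simp [typeCount, displacement]
  | cons p e ih =>
    simp only [typeCount, Nat.cast_add, Nat.cast_ite, Nat.cast_one, Nat.cast_zero]
    rw [displacement_add_single, hpos.arrow e, ih, add_assoc]

lemma IsPlanarDrawing.translate {pos : V → ℤ × ℤ} (hpos : IsPlanarDrawing ty pos) {τ : ℤ × ℤ}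
    (hτ : Even (τ.1 + τ.2)) : IsPlanarDrawing ty (fun x => pos x + τ) where
  injective x y h := hpos.injective (add_right_cancel h)
  range_eq := by
    ext P
    have h := Set.ext_iff.1 hpos.range_eq (P - τ)
    simp only [Set.mem_range, Set.mem_ofPred_eq, Prod.fst_sub, Prod.snd_sub] at h ⊢
    simp only [eq_sub_iff_add_eq] at h
    rw [h]
    grind
  arrow x y e := by rw [hpos.arrow e, add_right_comm]

/-- Any two drawings differ by a translation. -/
lemma IsPlanarDrawing.exists_eq_add (hQ : IsZnQuiver ty) {pos pos' : V → ℤ × ℤ}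
    (hpos : IsPlanarDrawing ty pos) (hpos' : IsPlanarDrawing ty pos') :
    ∃ τ : ℤ × ℤ, ∀ x, pos' x = pos x + τ := by
  obtain ⟨x₀⟩ := hQ.nonempty
  refine ⟨pos' x₀ - pos x₀, fun x => ?_⟩
  obtain ⟨p, -⟩ := hQ.exists_admissible x₀ x
  rw [hpos.pos_eq_add p, hpos'.pos_eq_add p]
  abel

lemma exists_path_typeCount (hQ : IsZnQuiver ty) (x : V) (n₀ n₁ n₂ : ℕ) :
    ∃ (y : V) (p : Quiver.Path x y), typeCount ty p = ![n₀, n₁, n₂] := by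
  have step : ∀ {y : V} (p : Quiver.Path x y) (a : Fin 3), ∃ (z : V) (q : Quiver.Path x z),
      typeCount ty q = fun b => typeCount ty p b + if a = b then 1 else 0 := fun {y} p a => by
    obtain ⟨⟨z, e⟩, he, -⟩ := hQ.existsUnique_arrow y a
    exact ⟨z, p.cons e, by ext b; simp only [typeCount, he]⟩
  induction n₂ with
  | zero =>
    induction n₁ with
    | zero =>
      induction n₀ with
      | zero => exact ⟨x, .nil, by ext a; fin_cases a <;> simp [typeCount]⟩
      | succ n ih =>
        obtain ⟨y, p, hp⟩ := ih
        obtain ⟨z, q, hq⟩ := step p 0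
        exact ⟨z, q, by rw [hq, hp]; ext a; fin_cases a <;> rfl⟩
    | succ n ih =>
      obtain ⟨y, p, hp⟩ := ih
      obtain ⟨z, q, hq⟩ := step p 1
      exact ⟨z, q, by rw [hq, hp]; ext a; fin_cases a <;> rfl⟩
  | succ n ih =>
    obtain ⟨y, p, hp⟩ := ih
    obtain ⟨z, q, hq⟩ := step p 2
    exact ⟨z, q, by rw [hq, hp]; ext a; fin_cases a <;> rfl⟩

lemma exists_isPlanarDrawing (hQ : IsZnQuiver ty) :
    ∃ pos : V → ℤ × ℤ, IsPlanarDrawing ty pos := by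
  obtain ⟨x₀⟩ := hQ.nonempty
  choose p _ using hQ.exists_admissible x₀
  have key : ∀ {y z : V} (q : Quiver.Path x₀ y) (q' : Quiver.Path x₀ z), y = z ↔
      displacement (fun a => typeCount ty q a) = displacement fun a => typeCount ty q' a :=
    fun q q' => by rw [displacement_eq_iff, hQ.target_eq_iff]
  refine ⟨fun y => (0, 1) + displacement fun a => typeCount ty (p y) a,
    fun y z h => (key _ _).2 (add_left_cancel h), ?_, fun x y e => ?_⟩
  · ext ⟨X, Y⟩
    simp only [Set.mem_range, Set.mem_ofPred_eq]
    constructor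
    · rintro ⟨y, h⟩
      simp only [displacement, Prod.mk_add_mk, Prod.mk.injEq] at h
      rw [← h.1, ← h.2]
      exact ⟨typeCount ty (p y) 0 - typeCount ty (p y) 2, by ring⟩
    · rintro ⟨m, hm⟩
      -- Lattice coordinates `(m, Y - 1 - m)`, made nonnegative by adding whole circuits.
      obtain ⟨y, q, hq⟩ := exists_path_typeCount hQ x₀ (m + (|m| + |Y - 1 - m|)).toNat
        (Y - 1 - m + (|m| + |Y - 1 - m|)).toNat (|m| + |Y - 1 - m|).toNat
      refine ⟨y, ?_⟩
      rw [(key (p y) q).1 rfl, hq]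
      have := neg_abs_le m
      have := neg_abs_le (Y - 1 - m)
      have := abs_nonneg m
      have := abs_nonneg (Y - 1 - m)
      ext <;> simp [displacement] <;> omega
  · have := (key (p y) ((p x).cons e)).1 rfl
    simp only [typeCount, Nat.cast_add, Nat.cast_ite, Nat.cast_one, Nat.cast_zero] at this
    rw [displacement_add_single] at this
    rw [this, add_assoc]

end Drawings

section Nets

variable {V : Type u} [Quiver.{v + 1} V] {ty : ∀ ⦃x y : V⦄, (x ⟶ y) → Fin 3}
variable {C : Type*} [Category C] {F : V ⥤q C}

/-! ### Simple representations -/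

@[simp] lemma pathMap_nil (x : V) : pathMap F (.nil : Quiver.Path x x) = 𝟙 _ := rfl

@[simp] lemma pathMap_cons {x y z : V} (p : Quiver.Path x y) (e : y ⟶ z) :
    pathMap F (p.cons e) = pathMap F p ≫ F.map e := rfl

lemma pathMap_comp {x y z : V} (p : Quiver.Path x y) (q : Quiver.Path y z) :
    pathMap F (p.comp q) = pathMap F p ≫ pathMap F q := by
  simp [pathMap]

variable [Abelian C]

/-- The vertex `y` can be reached from `x` along a path inducing a nonzero map. -/
def Reaches (F : V ⥤q C) (x y : V) : Prop :=
  ∃ p : Quiver.Path x y, pathMap F p ≠ 0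

/-- The arrows of type `a` leaving `x` (in a `ℤ²`-quiver there is just one) correspond to zero
maps. -/
def Vanishes (ty : ∀ ⦃x y : V⦄, (x ⟶ y) → Fin 3) (F : V ⥤q C) (a : Fin 3) (x : V) : Prop :=
  ∀ ⦃y : V⦄ (e : x ⟶ y), ty e = a → F.map e = 0

lemma vanishes_iff (hQ : IsZnQuiver ty) {x y : V} {e : x ⟶ y} {a : Fin 3} (he : ty e = a) :
    Vanishes ty F a x ↔ F.map e = 0 := by
  subst he
  refine ⟨fun h => h e rfl, fun h y' e' he' => ?_⟩
  obtain ⟨rfl, h'⟩ := Sigma.mk.inj_iff.1 ((hQ.existsUnique_arrow x (ty e)).unique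
    (y₁ := ⟨y', e'⟩) (y₂ := ⟨y, e⟩) he' rfl)
  rw [eq_of_heq h', h]

lemma comp_ne_zero_of_simple {X Y Z : C} [Simple X] [Simple Y] {f : X ⟶ Y} {g : Y ⟶ Z}
    (hf : f ≠ 0) (hg : g ≠ 0) : f ≫ g ≠ 0 := by
  have := isIso_of_hom_simple hf
  rwa [Ne, ← cancel_epi f, comp_zero] at hg

lemma Reaches.refl (hF : IsSimpleRep F) (x : V) : Reaches F x x := by
  have := hF x
  exact ⟨.nil, id_nonzero (F.obj x)⟩

lemma Reaches.cons (hF : IsSimpleRep F) {x y z : V} (h : Reaches F x y) {e : y ⟶ z}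
    (he : F.map e ≠ 0) : Reaches F x z := by
  obtain ⟨p, hp⟩ := h
  have := hF x
  have := hF y
  exact ⟨p.cons e, comp_ne_zero_of_simple hp he⟩

lemma Reaches.pathMap_ne_zero {k : Type*} [Field k] [Linear k C] (hF : IsLinkedNet k ty F) {x y : V}
    (h : Reaches F x y) {q : Quiver.Path x y} (hq : IsAdmissible ty q) : pathMap F q ≠ 0 := by
  obtain ⟨p, hp⟩ := h
  obtain ⟨c, hc⟩ := hF.map_eq_smul p q hq
  intro h
  rw [h, smul_zero] at hc
  exact hp hc

lemma isOneGenerated_iff (hF : IsSimpleRep F) (H : Set V) :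
    IsOneGenerated F H ↔ ∀ y, ∃ x ∈ H, Reaches F x y := by
  refine forall_congr' fun y => exists_congr fun x => and_congr_right fun _ => exists_congr
    fun p => ⟨fun h h0 => ?_, fun h => ?_⟩
  · have := hF y
    rw [h0] at h
    exact id_nonzero (F.obj y) ((cancel_epi (0 : F.obj x ⟶ F.obj y)).1 (by simp))
  · have := hF x
    have := hF y
    have := isIso_of_hom_simple h
    infer_instance

lemma imageSubobject_eq_top_of_simple {X Y : C} [Simple X] [Simple Y] {f : X ⟶ Y} (hf : f ≠ 0) :
    imageSubobject f = ⊤ := by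
  have := isIso_of_hom_simple hf
  rw [imageSubobject_mono, Subobject.mk_eq_top_of_isIso]

lemma kernelSubobject_eq_bot_of_simple {X Y : C} [Simple X] {f : X ⟶ Y} (hf : f ≠ 0) :
    kernelSubobject f = ⊥ := by
  have := mono_of_nonzero_from_simple hf
  exact Subobject.mk_eq_bot_iff_zero.2 (kernel.ι_of_mono f)

lemma isGenerated_iff (hF : IsSimpleRep F) (H : Set V) :
    IsGenerated F H ↔ ∀ y, ∃ x ∈ H, Reaches F x y := by
  refine forall_congr' fun y => ⟨fun ⟨s, hs⟩ => ?_, fun ⟨x, hx, p, hp⟩ => ?_⟩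
  · by_contra! h
    have := hF y
    have hbot : (s.sup fun p => imageSubobject (pathMap F p.2)) = ⊥ := by
      rw [Finset.sup_eq_bot_iff]
      intro p _
      have hp : pathMap F p.2 = 0 := by
        by_contra hp
        exact h p.1 p.1.2 ⟨p.2, hp⟩
      rw [hp, imageSubobject_zero]
    exact bot_ne_top (hbot.symm.trans hs)
  · have := hF x
    have := hF y
    exact ⟨{⟨⟨x, hx⟩, p⟩}, by
      rw [Finset.sup_singleton]; exact imageSubobject_eq_top_of_simple hp⟩

/-! ### The vanishing pattern of a net -/

section Chart

variable {pos : V → ℤ × ℤ}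

/-- The vertex with the given lattice coordinates in a planar drawing. -/
noncomputable def IsPlanarDrawing.vertex (hpos : IsPlanarDrawing ty pos) (P : ℤ × ℤ) : V :=
  (show (P.1 - P.2, P.1 + P.2 + 1) ∈ Set.range pos by
    rw [hpos.range_eq]; exact ⟨P.1, by ring⟩).choose

lemma IsPlanarDrawing.pos_vertex (hpos : IsPlanarDrawing ty pos) (P : ℤ × ℤ) :
    pos (hpos.vertex P) = (P.1 - P.2, P.1 + P.2 + 1) :=
  (show (P.1 - P.2, P.1 + P.2 + 1) ∈ Set.range pos by
    rw [hpos.range_eq]; exact ⟨P.1, by ring⟩).choose_spec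

lemma IsPlanarDrawing.exists_eq_vertex (hpos : IsPlanarDrawing ty pos) (x : V) :
    ∃ P, x = hpos.vertex P := by
  have h : pos x ∈ Set.range pos := ⟨x, rfl⟩
  rw [hpos.range_eq] at h
  obtain ⟨m, hm⟩ := h
  refine ⟨(m, m - (pos x).1), hpos.injective ?_⟩
  rw [hpos.pos_vertex]
  ext <;> simp
  omega

lemma IsPlanarDrawing.eq_vertex_add (hpos : IsPlanarDrawing ty pos) {P : ℤ × ℤ} {y : V}
    (e : hpos.vertex P ⟶ y) : y = hpos.vertex (P + latticeStep (ty e)) := by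
  apply hpos.injective
  rw [hpos.arrow e, hpos.pos_vertex, hpos.pos_vertex]
  generalize ty e = a
  fin_cases a <;> ext <;> simp [latticeStep, direction] <;> ring

lemma IsPlanarDrawing.exists_arrow (hQ : IsZnQuiver ty) (hpos : IsPlanarDrawing ty pos) (P : ℤ × ℤ)
    (a : Fin 3) : ∃ e : hpos.vertex P ⟶ hpos.vertex (P + latticeStep a), ty e = a := by
  obtain ⟨⟨y, e⟩, he, -⟩ := hQ.existsUnique_arrow (hpos.vertex P) a
  dsimp only at he
  obtain rfl : y = hpos.vertex (P + latticeStep a) := by rw [← he]; exact hpos.eq_vertex_add e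
  exact ⟨e, he⟩

variable {k : Type*} [Field k] [Linear k C]

lemma Reaches.vertex_add (hQ : IsZnQuiver ty) (hF : IsSimpleRep F) (hpos : IsPlanarDrawing ty pos)
    {x : V} {P : ℤ × ℤ} {a : Fin 3} (h : Reaches F x (hpos.vertex P))
    (ha : ¬ Vanishes ty F a (hpos.vertex P)) : Reaches F x (hpos.vertex (P + latticeStep a)) := by
  obtain ⟨e, he⟩ := hpos.exists_arrow hQ P a
  exact h.cons hF ((vanishes_iff hQ he).not.1 ha)

/-- A single arrow is an admissible path, so if it vanishes, its target cannot be reached from its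
source along any other path either. -/
lemma not_reaches_add (hQ : IsZnQuiver ty) (hF : IsLinkedNet k ty F) (hpos : IsPlanarDrawing ty pos)
    {P : ℤ × ℤ} {a : Fin 3} (ha : Vanishes ty F a (hpos.vertex P)) :
    ¬ Reaches F (hpos.vertex P) (hpos.vertex (P + latticeStep a)) := by
  obtain ⟨e, he⟩ := hpos.exists_arrow hQ P a
  intro h
  refine h.pathMap_ne_zero hF (q := .cons .nil e) ⟨a + 1, ?_⟩ ?_
  · simp [typeCount, he]
  · rw [pathMap_cons, (vanishes_iff hQ he).1 ha, comp_zero]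

lemma not_reaches_add_add (hQ : IsZnQuiver ty) (hF : IsLinkedNet k ty F)
    (hpos : IsPlanarDrawing ty pos) {P : ℤ × ℤ} {a b : Fin 3}
    (h : Vanishes ty F a (hpos.vertex P) ∨ Vanishes ty F b (hpos.vertex (P + latticeStep a))) :
    ¬ Reaches F (hpos.vertex P) (hpos.vertex (P + latticeStep a + latticeStep b)) := by
  obtain ⟨e, he⟩ := hpos.exists_arrow hQ P a
  obtain ⟨e', he'⟩ := hpos.exists_arrow hQ (P + latticeStep a) b
  obtain ⟨c, hc, hc'⟩ : ∃ c : Fin 3, a ≠ c ∧ b ≠ c := by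
    clear * -
    revert a b
    decide
  intro h'
  refine h'.pathMap_ne_zero hF (q := .cons (.cons .nil e) e') ⟨c, ?_⟩ ?_
  · simp [typeCount, he, he', hc, hc']
  · rw [pathMap_cons, pathMap_cons]
    obtain h | h := h
    · rw [(vanishes_iff hQ he).1 h, comp_zero, zero_comp]
    · rw [(vanishes_iff hQ he').1 h, comp_zero]

lemma isVanishingPattern (hQ : IsZnQuiver ty) (hF : IsLinkedNet k ty F) (hS : IsSimpleRep F)
    (hpos : IsPlanarDrawing ty pos) :
    IsVanishingPattern fun a P => Vanishes ty F a (hpos.vertex P) where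
  disjoint {a b P} hab ha hb := by
    obtain ⟨e, he⟩ := hpos.exists_arrow hQ P a
    obtain ⟨e', he'⟩ := hpos.exists_arrow hQ P b
    have := hS (hpos.vertex P)
    have h := hF.ker_inf_ker (.cons .nil e) (.cons .nil e') ⟨b, by simp [typeCount, he, hab]⟩
      ⟨a, by simp [typeCount, he', hab.symm]⟩ fun c => by
        by_cases hc : a = c
        · exact Or.inr (by simp [typeCount, he', ← hc, hab.symm])
        · exact Or.inl (by simp [typeCount, he, hc])
    rw [pathMap_cons, pathMap_cons, (vanishes_iff hQ he).1 ha, (vanishes_iff hQ he').1 hb,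
      comp_zero, comp_zero, kernelSubobject_zero, kernelSubobject_zero, inf_top_eq] at h
    exact top_ne_bot h
  square {a b P} _ h := by
    by_contra! h'
    refine not_reaches_add_add hQ hF hpos h ?_
    rw [add_right_comm]
    exact ((Reaches.refl hS _).vertex_add hQ hS hpos h'.1).vertex_add hQ hS hpos h'.2
  circuit {a b c P} hab hac hbc := by
    obtain ⟨e, he⟩ := hpos.exists_arrow hQ P a
    obtain ⟨e', he'⟩ := hpos.exists_arrow hQ (P + latticeStep a) b
    obtain ⟨e'', he''⟩ := hpos.exists_arrow hQ (P + latticeStep a + latticeStep b) c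
    rw [vanishes_iff hQ he, vanishes_iff hQ he', vanishes_iff hQ he'']
    have h := hF.map_circuit (.cons (.cons (.cons .nil e) e') e'') (by
      have key : ∀ d, typeCount ty (.cons (.cons (.cons .nil e) e') e'') d = 1 := fun d => by
        simp only [typeCount, he, he', he'']
        clear * - hab hac hbc
        revert a b c d
        decide
      exact ⟨fun d => (key d).le, fun ⟨d, hd⟩ => by rw [key] at hd; omega⟩)
    by_contra! h'
    have := hS (hpos.vertex P)
    have := hS (hpos.vertex (P + latticeStep a))
    have := hS (hpos.vertex (P + latticeStep a + latticeStep b))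
    rw [pathMap_cons, pathMap_cons, pathMap_cons, pathMap_nil, Category.id_comp] at h
    exact comp_ne_zero_of_simple (comp_ne_zero_of_simple h'.1 h'.2.1) h'.2.2 h

end Chart

variable {k : Type*} [Field k] [Linear k C] {pos : V → ℤ × ℤ}

/-! ### Local finiteness and exactness -/

lemma exists_path_of_not_vanishes (hQ : IsZnQuiver ty) (hS : IsSimpleRep F)
    (hpos : IsPlanarDrawing ty pos) {a : Fin 3} {P : ℤ × ℤ} (n : ℕ)
    (h : ∀ m < n, ¬ Vanishes ty F a (hpos.vertex (P + m • latticeStep a))) :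
    ∃ p : Quiver.Path (hpos.vertex P) (hpos.vertex (P + n • latticeStep a)),
      p.length = n ∧ pathMap F p ≠ 0 := by
  induction n with
  | zero =>
    rw [zero_nsmul, add_zero]
    have := hS (hpos.vertex P)
    exact ⟨.nil, rfl, id_nonzero _⟩
  | succ n ih =>
    obtain ⟨p, hp, hp'⟩ := ih fun m hm => h m (by omega)
    obtain ⟨e, he⟩ := hpos.exists_arrow hQ (P + n • latticeStep a) a
    rw [succ_nsmul, ← add_assoc]
    have := hS (hpos.vertex P)
    have := hS (hpos.vertex (P + n • latticeStep a))
    refine ⟨p.cons e, by rw [Quiver.Path.length_cons, hp],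
      comp_ne_zero_of_simple hp' ((vanishes_iff hQ he).not.1 (h n (by omega)))⟩

lemma IsLocallyFinite.exists_vanishes (hQ : IsZnQuiver ty) (hS : IsSimpleRep F)
    (hpos : IsPlanarDrawing ty pos) (hF : IsLocallyFinite F) (a : Fin 3) (P : ℤ × ℤ) :
    ∃ n : ℕ, Vanishes ty F a (hpos.vertex (P - n • latticeStep a)) := by
  by_contra! h
  obtain ⟨l, hl⟩ := hF (hpos.vertex P)
  obtain ⟨p, hp, hp'⟩ := exists_path_of_not_vanishes hQ hS hpos (P := P - (l + 1) • latticeStep a)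
    (l + 1) fun m hm => by
      convert h (l + 1 - m) using 3
      rw [sub_nsmul _ hm.le]
      abel
  rw [← sub_add_cancel P ((l + 1) • latticeStep a)] at hl
  exact hp' (hl _ p (by omega))

lemma IsNeighbor.exists_eq_vertex (hpos : IsPlanarDrawing ty pos) {P : ℤ × ℤ} {y : V}
    (h : IsNeighbor ty (hpos.vertex P) y) : ∃ a b, a ≠ b ∧
      (y = hpos.vertex (P + latticeStep a) ∨
        y = hpos.vertex (P + latticeStep a + latticeStep b)) := by
  obtain ⟨hne, p, hp⟩ := h
  obtain ⟨Q, rfl⟩ := hpos.exists_eq_vertex y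
  have hdis := hpos.pos_eq_add p
  rw [hpos.pos_vertex, hpos.pos_vertex] at hdis
  have hne' : Q ≠ P := fun h => hne (h ▸ rfl)
  have h₀ := hp 0
  have h₁ := hp 1
  have h₂ := hp 2
  obtain ⟨i, j⟩ := P
  obtain ⟨i', j'⟩ := Q
  simp only [displacement, Prod.mk_add_mk, Prod.mk.injEq, ne_eq] at hdis hne'
  suffices h : ∃ a b, a ≠ b ∧ ((i', j') = (i, j) + latticeStep a ∨
      (i', j') = (i, j) + latticeStep a + latticeStep b) by
    obtain ⟨a, b, hab, h | h⟩ := h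
    · exact ⟨a, b, hab, Or.inl (h ▸ rfl)⟩
    · exact ⟨a, b, hab, Or.inr (h ▸ rfl)⟩
  generalize typeCount ty p 0 = n₀, typeCount ty p 1 = n₁, typeCount ty p 2 = n₂ at *
  by_cases h : (n₀ = 1 ∧ n₁ = 0 ∧ n₂ = 0) ∨ (n₀ = 1 ∧ n₁ = 1 ∧ n₂ = 0)
  · exact ⟨0, 1, by decide, by simp [latticeStep]; omega⟩
  by_cases h' : (n₀ = 0 ∧ n₁ = 1 ∧ n₂ = 0) ∨ (n₀ = 0 ∧ n₁ = 1 ∧ n₂ = 1)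
  · exact ⟨1, 2, by decide, by simp [latticeStep]; omega⟩
  · exact ⟨2, 0, by decide, by simp [latticeStep]; omega⟩

/-- Neighbors do not reach each other in both directions, because of the circuit through them. -/
lemma not_reaches_and_reaches (hQ : IsZnQuiver ty) (hF : IsLinkedNet k ty F) (hS : IsSimpleRep F)
    (hpos : IsPlanarDrawing ty pos) (P : ℤ × ℤ) (a : Fin 3) :
    ¬ (Reaches F (hpos.vertex P) (hpos.vertex (P + latticeStep a)) ∧
      Reaches F (hpos.vertex (P + latticeStep a)) (hpos.vertex P)) := by
  rintro ⟨h, h'⟩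
  obtain ⟨b, c, hab, hac, hbc⟩ : ∃ b c, a ≠ b ∧ a ≠ c ∧ b ≠ c := by
    clear * -
    revert a; decide
  have h₁ := mt (not_reaches_add hQ hF hpos) (not_not.2 h)
  have h₂ := mt (not_reaches_add_add hQ hF hpos (P := P + latticeStep a) (a := b) (b := c)) (by
    rwa [not_not, add_assoc P, add_assoc P, latticeStep_add_add hab hac hbc, add_zero])
  exact ((isVanishingPattern hQ hF hS hpos).circuit (P := P) hab hac hbc).elim h₁ h₂

lemma vanishes_of_not_reaches (hQ : IsZnQuiver ty) (hS : IsSimpleRep F)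
    (hpos : IsPlanarDrawing ty pos) {P : ℤ × ℤ} {a b c : Fin 3} (hab : a ≠ b) (hac : a ≠ c)
    (hbc : b ≠ c) (h : ¬ Reaches F (hpos.vertex P) (hpos.vertex (P + latticeStep a)))
    (h' : ¬ Reaches F (hpos.vertex (P + latticeStep a)) (hpos.vertex P)) :
    Vanishes ty F a (hpos.vertex P) ∧ (Vanishes ty F b (hpos.vertex (P + latticeStep a)) ∨
      Vanishes ty F c (hpos.vertex (P + latticeStep a + latticeStep b))) := by
  refine ⟨?_, ?_⟩
  · by_contra ha
    exact h ((Reaches.refl hS _).vertex_add hQ hS hpos ha)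
  · by_contra! hb
    have := ((Reaches.refl hS _).vertex_add hQ hS hpos hb.1).vertex_add hQ hS hpos hb.2
    rw [add_assoc P, add_assoc P, latticeStep_add_add hab hac hbc, add_zero] at this
    exact h' this

/-- In a simple linked net exactness fails only at neighbors neither of which reaches the other. -/
lemma exists_vanishes_of_not_isExactRep (hQ : IsZnQuiver ty) (hF : IsLinkedNet k ty F)
    (hS : IsSimpleRep F) (hpos : IsPlanarDrawing ty pos) (h : ¬ IsExactRep ty F) :
    ∃ a b c P, a ≠ b ∧ a ≠ c ∧ b ≠ c ∧ Vanishes ty F a (hpos.vertex P) ∧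
      (Vanishes ty F b (hpos.vertex (P + latticeStep a)) ∨
        Vanishes ty F c (hpos.vertex (P + latticeStep a + latticeStep b))) := by
  unfold IsExactRep at h
  push Not at h
  obtain ⟨x, y, hxy, p, q, hp, hq, hne⟩ := h
  have := hS x
  have := hS y
  have key : Reaches F x y ↔ Reaches F y x := by
    by_cases h₁ : pathMap F p = 0 <;> by_cases h₂ : pathMap F q = 0
    · exact iff_of_false (fun h => h.pathMap_ne_zero hF hp h₁) fun h => h.pathMap_ne_zero hF hq h₂
    · simp [h₁, kernelSubobject_eq_bot_of_simple h₂] at hne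
    · simp [h₂, imageSubobject_eq_top_of_simple h₁] at hne
    · exact iff_of_true ⟨p, h₁⟩ ⟨q, h₂⟩
  obtain ⟨P, rfl⟩ := hpos.exists_eq_vertex x
  obtain ⟨a, b, hab, hy⟩ := hxy.exists_eq_vertex hpos
  obtain ⟨c, hac, hbc⟩ : ∃ c, a ≠ c ∧ b ≠ c := by
    clear * -
    revert a b; decide
  obtain rfl | rfl := hy
  · have h := not_reaches_and_reaches hQ hF hS hpos P a
    rw [← key, and_self] at h
    exact ⟨a, b, c, P, hab, hac, hbc,
      vanishes_of_not_reaches hQ hS hpos hab hac hbc h (mt key.2 h)⟩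
  -- Here `P` is reached from the other vertex by an arrow of type `c`.
  · have h := not_reaches_and_reaches hQ hF hS hpos (P + latticeStep a + latticeStep b) c
    have hP : P + latticeStep a + latticeStep b + latticeStep c = P := by
      rw [add_assoc P, add_assoc P, latticeStep_add_add hab hac hbc, add_zero]
    rw [hP, ← key, and_self] at h
    refine ⟨c, a, b, P + latticeStep a + latticeStep b, hac.symm, hbc.symm, hab,
      vanishes_of_not_reaches hQ hS hpos hac.symm hbc.symm hab ?_ ?_⟩
    · rw [hP]
      exact mt key.2 h
    · rwa [hP]

/-! ### Configurations -/

section Configuration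

variable {t : ConfigType}

lemma IsConfiguration.vanishes (h : IsConfiguration ty F t pos) (a : Fin 3) (i j : ℤ)
    (hm : ((i - j, i + j + 1), a) ∈ t.red) : Vanishes ty F a (h.drawing.vertex (i, j)) := by
  rintro y e rfl
  exact h.red e (by rwa [h.drawing.pos_vertex])

lemma IsConfiguration.not_vanishes (hQ : IsZnQuiver ty) (h : IsConfiguration ty F t pos) (a : Fin 3)
    (i j : ℤ) (hm : ((i - j, i + j + 1), a) ∈ t.blue) :
    ¬ Vanishes ty F a (h.drawing.vertex (i, j)) := by
  obtain ⟨e, he⟩ := h.drawing.exists_arrow hQ (i, j) a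
  intro hv
  exact h.blue e (by rwa [h.drawing.pos_vertex, he]) (hv e he)

lemma exists_admitsConfiguration (hQ : IsZnQuiver ty) (hF : IsLinkedNet k ty F)
    (hS : IsSimpleRep F) (hfin : IsLocallyFinite F) (hne : ¬ IsExactRep ty F) :
    ∃ t : ConfigType, AdmitsConfiguration ty F t := by
  obtain ⟨pos, hpos⟩ := exists_isPlanarDrawing hQ
  obtain ⟨t, τ, hτ, h⟩ := (isVanishingPattern hQ hF hS hpos).exists_configType
    (hfin.exists_vanishes hQ hS hpos) (exists_vanishes_of_not_isExactRep hQ hF hS hpos hne)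
  refine ⟨t, _, hpos.translate hτ, fun x y e hm => ?_, fun x y e hm => ?_⟩ <;>
    obtain ⟨⟨i, j⟩, rfl⟩ := hpos.exists_eq_vertex x <;> rw [hpos.pos_vertex] at hm
  · exact (h _ i j).1 hm e rfl
  · exact fun h0 => (h _ i j).2 hm ((vanishes_iff hQ rfl).2 h0)

lemma exists_orange_reaches (hQ : IsZnQuiver ty) (hF : IsLinkedNet k ty F)
    (hS : IsSimpleRep F) (h : IsConfiguration ty F t pos) (y : V) :
    ∃ x ∈ orangeVertices t pos, Reaches F x y := by
  obtain ⟨⟨i, j⟩, rfl⟩ := h.drawing.exists_eq_vertex y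
  obtain ⟨i', j', hm, hR⟩ := (isVanishingPattern hQ hF hS h.drawing).exists_orange_rel h.vanishes
    (h.not_vanishes hQ) (R := fun P Q => Reaches F (h.drawing.vertex P) (h.drawing.vertex Q))
    (fun P => Reaches.refl hS _) (fun a P Q hR ha => hR.vertex_add hQ hS h.drawing ha) i j
  exact ⟨_, by rwa [orangeVertices, Set.mem_preimage, h.drawing.pos_vertex], hR⟩

/-- The set of orange vertices does not depend on the configuration: it consists of the vertices
at which no nonzero arrow arrives. -/
lemma mem_orangeVertices_iff (hQ : IsZnQuiver ty) (hF : IsLinkedNet k ty F)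
    (hS : IsSimpleRep F) (h : IsConfiguration ty F t pos) (y : V) :
    y ∈ orangeVertices t pos ↔ ∀ ⦃x : V⦄ (e : x ⟶ y), F.map e = 0 := by
  refine ⟨fun hy x e => ?_, fun hy => ?_⟩
  · obtain ⟨⟨i, j⟩, rfl⟩ := h.drawing.exists_eq_vertex y
    obtain ⟨Q, rfl⟩ := h.drawing.exists_eq_vertex x
    rw [orangeVertices, Set.mem_preimage, h.drawing.pos_vertex] at hy
    have := (isVanishingPattern hQ hF hS h.drawing).of_mem_orange h.vanishes (ty e) i j hy
    have hQ' : (i, j) - latticeStep (ty e) = Q := by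
      have := h.drawing.eq_vertex_add e
      have := congrArg pos this
      rw [h.drawing.pos_vertex, h.drawing.pos_vertex] at this
      simp only [Prod.mk.injEq] at this
      ext <;> simp at * <;> omega
    rw [hQ'] at this
    exact this e rfl
  · obtain ⟨x, hx, p, hp⟩ := exists_orange_reaches hQ hF hS h y
    cases p with
    | nil => exact hx
    | cons p e =>
      rw [pathMap_cons, hy e, comp_zero] at hp
      exact absurd rfl hp

lemma isMinimallyWith_orangeVertices (hQ : IsZnQuiver ty) (hF : IsLinkedNet k ty F)
    (hS : IsSimpleRep F) (h : IsConfiguration ty F t pos) {P : Set V → Prop}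
    (hP : ∀ H, P H ↔ ∀ y, ∃ x ∈ H, Reaches F x y) : IsMinimallyWith P (orangeVertices t pos) := by
  refine ⟨(hP _).2 (exists_orange_reaches hQ hF hS h), fun H hH hPH => hH.not_subset fun y hy => ?_⟩
  obtain ⟨x, hx, p, hp⟩ := (hP H).1 hPH y
  cases p with
  | nil => exact hx
  | cons p e =>
    rw [pathMap_cons, (mem_orangeVertices_iff hQ hF hS h y).1 hy e, comp_zero] at hp
    exact absurd rfl hp

lemma ncard_orange (t : ConfigType) : t.orange.ncard = t.numOrange := by
  cases t
  · exact Set.ncard_pair (by decide)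
  · exact Set.ncard_pair (by decide)
  · exact Set.ncard_pair (by decide)
  · exact Set.ncard_eq_three.2 ⟨_, _, _, by decide, by decide, by decide, rfl⟩
  · exact Set.ncard_eq_three.2 ⟨_, _, _, by decide, by decide, by decide, rfl⟩

lemma odd_of_mem_orange {P : ℤ × ℤ} (h : P ∈ t.orange) : Odd (P.1 + P.2) := by
  cases t <;> simp only [ConfigType.orange, Set.mem_insert_iff, Set.mem_singleton_iff] at h <;>
    rcases h with rfl | rfl | rfl <;> decide

lemma ncard_orangeVertices (hpos : IsPlanarDrawing ty pos) (t : ConfigType) :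
    (orangeVertices t pos).ncard = t.numOrange := by
  rw [← ncard_orange, orangeVertices]
  exact Set.ncard_preimage_of_injective_subset_range hpos.injective
    (hpos.range_eq ▸ fun P hP => odd_of_mem_orange hP)

/-- The sets of orange vertices of different types are not translates of each other. -/
lemma eq_of_orange_translate {t t' : ConfigType} {τ : ℤ × ℤ}
    (h : ∀ P ∈ t.orange, P + τ ∈ t'.orange) (h' : ∀ P ∈ t'.orange, P - τ ∈ t.orange) : t = t' := by
  obtain ⟨τ₁, τ₂⟩ := τ
  cases t <;> cases t' <;> first
    | rfl
    | (exfalso; simp [ConfigType.orange] at h h'; omega)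

lemma eq_of_isConfiguration (hQ : IsZnQuiver ty) (hF : IsLinkedNet k ty F)
    (hS : IsSimpleRep F) {t t' : ConfigType} {pos pos' : V → ℤ × ℤ}
    (h : IsConfiguration ty F t pos) (h' : IsConfiguration ty F t' pos') : t = t' := by
  obtain ⟨τ, hτ⟩ := h.drawing.exists_eq_add hQ h'.drawing
  have key : ∀ x, pos x ∈ t.orange ↔ pos x + τ ∈ t'.orange := fun x => by
    rw [← hτ]
    exact (mem_orangeVertices_iff hQ hF hS h x).trans (mem_orangeVertices_iff hQ hF hS h' x).symm
  refine eq_of_orange_translate (τ := τ) (fun P hP => ?_) fun P hP => ?_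
  · obtain ⟨x, rfl⟩ : P ∈ Set.range pos := h.drawing.range_eq ▸ odd_of_mem_orange hP
    exact (key x).1 hP
  · obtain ⟨x, rfl⟩ : P ∈ Set.range pos' := h'.drawing.range_eq ▸ odd_of_mem_orange hP
    rw [hτ] at hP ⊢
    rw [add_sub_cancel_right]
    exact (key x).2 hP

end Configuration

end Nets

end LinkedNets

open CategoryTheory LinkedNets in
theorem mainTheorem10
    {k : Type*} [Field k] {C : Type*} [Category C] [Abelian C] [Linear k C]
    {V : Type u} [Quiver.{v + 1} V]
    (ty : ∀ ⦃x y : V⦄, (x ⟶ y) → Fin 3) (hQ : IsZnQuiver ty)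
    (F : V ⥤q C) (hlinked : IsLinkedNet k ty F) (hsimple : IsSimpleRep F) :
    (IsLocallyFinite F → ¬ IsExactRep ty F → ∃ t : ConfigType, AdmitsConfiguration ty F t) ∧
    (∀ (t : ConfigType) (pos : V → ℤ × ℤ), IsConfiguration ty F t pos →
      (orangeVertices t pos).ncard = t.numOrange ∧
      IsMinimallyWith (IsOneGenerated F) (orangeVertices t pos) ∧
      IsMinimallyWith (IsGenerated F) (orangeVertices t pos)) ∧
    (∀ t t' : ConfigType, AdmitsConfiguration ty F t → AdmitsConfiguration ty F t' → t = t') := by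
  refine ⟨exists_admitsConfiguration hQ hlinked hsimple, fun t pos h => ⟨?_, ?_, ?_⟩,
    fun t t' ⟨pos, h⟩ ⟨pos', h'⟩ => eq_of_isConfiguration hQ hlinked hsimple h h'⟩
  · exact ncard_orangeVertices h.drawing t
  · exact isMinimallyWith_orangeVertices hQ hlinked hsimple h (isOneGenerated_iff hsimple)
  · exact isMinimallyWith_orangeVertices hQ hlinked hsimple h (isGenerated_iff hsimple)
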